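/- A \emph{cycle set} is a finite set $X$ with a binary operation $\cdot$ such that $(x\cdot y)\cdot(x\cdot z)=(y\cdot x)\cdot(y\cdot z)$ for all $x,y,z\in X$, every map $\sigma_x\colon y\mapsto x\cdot y$ is bijective, and the map $x\mapsto x\cdot x$ is bijective. Its permutation group is $\mathcal{G}(X)=\langle\sigma_x\mid x\in X\rangle\le \mathrm{Sym}_X$. The cycle set $X$ is \emph{indecomposable} if it is not the disjoint union of two non-empty subsets that are each closed under $\cdot$, and \emph{irretractable} if $x\mapsto\sigma_x^{-1}$ is injective. Let $p$ be a prime and let $\mathbb{Z}_p=\mathbb{Z}/p\mathbb{Z}$. Let $\mathcal{F}_p$ be the set of all non-constant maps $\Phi\colon\mathbb{Z}_p\to\mathbb{Z}_p$ with $\Phi(A)=\Phi(-A)$ for all $A\in\mathbb{Z}_p$. The group $\mathbb{Z}_p^{*}$ acts on $\mathcal{F}_p$ by $({}^{\alpha}\Phi)(A)=\alpha^{-1}\Phi(\alpha A)$. Let $\mathcal{R}_p\subseteq\mathcal{F}_p$ be a system of representatives for the orbits of this action, that is, a subset containing exactly one element of each orbit. \textbf{Theorem.} Let $X$ be an indecomposable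 irretractable cycle set of size $p^2$ such that $\mathcal{G}(X)$ is a $p$-group. \begin{enumerate} \item There is a unique $\Phi\in\mathcal{R}_p$ such that $X$ is isomorphic to the cycle set on $\mathbb{Z}_p\times\mathbb{Z}_p$ with multiplication \[(a,x)\cdot(b,y)=(b+x,\;y+\Phi(b-a)).\] \item Let $\Phi$ be as in (1), and identify $X$ with $\mathbb{Z}_p\times\mathbb{Z}_p$ along any such isomorphism. Then the automorphisms of $X$ are exactly the maps $(a,x)\mapsto(\alpha a+\beta,\alpha x)$ with $\alpha\in\mathbb{Z}_p^{*}$, $\beta\in\mathbb{Z}_p$ and ${}^{\alpha}\Phi=\Phi$. \end{enumerate} -/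

import Mathlib

/-- A (non-degenerate) cycle set: a set with a binary operation `(x, y) ↦ x · y` (here `op x y`)
satisfying (C1), (C2), (C3). Finiteness is imposed where it is used. -/
class CycleSet (X : Type*) where
  /-- The operation `x · y`. -/
  op : X → X → X
  /-- (C1): `(x · y) · (x · z) = (y · x) · (y · z)`. -/
  op_op_op : ∀ x y z : X, op (op x y) (op x z) = op (op y x) (op y z)
  /-- (C2): every map `y ↦ x · y` is bijective. -/
  bijective_op : ∀ x : X, Function.Bijective (fun y => op x y)
  /-- (C3): the square map `x ↦ x · x` is bijective. -/
  bijective_sq : Function.Bijective (fun x : X => op x x)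

namespace CycleSet

/-- The permutation `σ_x : y ↦ x · y`. -/
noncomputable def sigma {X : Type*} [CycleSet X] (x : X) : Equiv.Perm X :=
  Equiv.ofBijective (fun y => op x y) (bijective_op x)

/-- The permutation group `𝒢(X) = ⟨σ_x ∣ x ∈ X⟩ ≤ Sym_X`. -/
def permutationGroup (X : Type*) [CycleSet X] : Subgroup (Equiv.Perm X) :=
  Subgroup.closure (Set.range (sigma (X := X)))

/-- `X` is indecomposable: it is not the disjoint union of two non-empty subsets, each closed
under the operation. -/
def IsIndecomposable (X : Type*) [CycleSet X] : Prop :=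
  ∀ A B : Set X, A.Nonempty → B.Nonempty → Disjoint A B → A ∪ B = Set.univ →
    (∀ x ∈ A, ∀ y ∈ A, op x y ∈ A) → (∀ x ∈ B, ∀ y ∈ B, op x y ∈ B) → False

/-- `X` is irretractable: the canonical map `x ↦ σ_x⁻¹` into the permutation group is injective. -/
def IsIrretractable (X : Type*) [CycleSet X] : Prop :=
  Function.Injective (fun x : X => (sigma x)⁻¹)

/-- `f` is a homomorphism of cycle sets. -/
def IsHom {X Y : Type*} [CycleSet X] [CycleSet Y] (f : X → Y) : Prop :=
  ∀ x y : X, f (op x y) = op (f x) (f y)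

end CycleSet

/-- The set `ℱ_p` of all non-constant functions `Φ : ℤ_p → ℤ_p` with `Φ(A) = Φ(-A)`. -/
@[ext]
structure EvenNonconst (p : ℕ) where
  /-- The underlying function `Φ`. -/
  toFun : ZMod p → ZMod p
  nonconst : ∃ A B : ZMod p, toFun A ≠ toFun B
  even : ∀ A : ZMod p, toFun A = toFun (-A)

namespace EvenNonconst

/-- The action `(^α Φ)(A) = α⁻¹ Φ(α A)` of `ℤ_p^*` on `ℱ_p`. -/
instance instMulAction (p : ℕ) : MulAction (ZMod p)ˣ (EvenNonconst p) where
  smul α Φ :=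
    { toFun := fun A => ((α⁻¹ : (ZMod p)ˣ) : ZMod p) * Φ.toFun ((α : ZMod p) * A)
      nonconst := by
        obtain ⟨A, B, h⟩ := Φ.nonconst
        refine ⟨((α⁻¹ : (ZMod p)ˣ) : ZMod p) * A, ((α⁻¹ : (ZMod p)ˣ) : ZMod p) * B, ?_⟩
        intro h'
        apply h
        simpa using h'
      even := by
        intro A
        rw [Φ.even, mul_neg] }
  one_smul Φ := by
    apply EvenNonconst.ext
    funext A
    change ((1⁻¹ : (ZMod p)ˣ) : ZMod p) * Φ.toFun (((1 : (ZMod p)ˣ) : ZMod p) * A) = Φ.toFun A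
    simp
  mul_smul α β Φ := by
    apply EvenNonconst.ext
    funext A
    change (((α * β)⁻¹ : (ZMod p)ˣ) : ZMod p) * Φ.toFun (((α * β : (ZMod p)ˣ) : ZMod p) * A) =
      ((α⁻¹ : (ZMod p)ˣ) : ZMod p) * (((β⁻¹ : (ZMod p)ˣ) : ZMod p) *
        Φ.toFun ((β : ZMod p) * ((α : ZMod p) * A)))
    rw [mul_inv, Units.val_mul, Units.val_mul, mul_assoc, mul_comm (α : ZMod p), mul_assoc]

/-- `R` is a system of representatives for the action of `ℤ_p^*` on `ℱ_p`: every orbit contains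
exactly one element of `R`. -/
def IsSystemOfRepresentatives {p : ℕ} (R : Set (EvenNonconst p)) : Prop :=
  ∀ Φ : EvenNonconst p, ∃! Ψ : EvenNonconst p, Ψ ∈ R ∧ Ψ ∈ MulAction.orbit (ZMod p)ˣ Φ

/-- The set `ℤ_p × ℤ_p`, tagged with the parameter `Φ` of the operation it carries below. -/
def Model {p : ℕ} (_Φ : EvenNonconst p) : Type := ZMod p × ZMod p

/-- The cycle set `ℤ_p × ℤ_p` with `(a, x) · (b, y) = (b + x, y + Φ(b - a))`. -/
instance instCycleSetModel {p : ℕ} (Φ : EvenNonconst p) : CycleSet (Model Φ) where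
  op u v := ((v.1 + u.2, v.2 + Φ.toFun (v.1 - u.1)) : ZMod p × ZMod p)
  op_op_op := by
    rintro ⟨a, x⟩ ⟨b, y⟩ ⟨c, z⟩
    have h : Φ.toFun (b - a) = Φ.toFun (a - b) := by rw [Φ.even, neg_sub]
    refine Prod.ext ?_ ?_
    · change c + x + (y + Φ.toFun (b - a)) = c + y + (x + Φ.toFun (a - b))
      rw [h]; ring
    · change z + Φ.toFun (c - a) + Φ.toFun (c + x - (b + x)) =
        z + Φ.toFun (c - b) + Φ.toFun (c + y - (a + y))
      rw [add_sub_add_right_eq_sub, add_sub_add_right_eq_sub]; ring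
  bijective_op := by
    rintro ⟨a, x⟩
    refine Function.bijective_iff_has_inverse.mpr
      ⟨fun w => ((w.1 - x, w.2 - Φ.toFun (w.1 - x - a)) : ZMod p × ZMod p), ?_, ?_⟩
    · rintro ⟨b, y⟩
      refine Prod.ext ?_ ?_ <;> simp
    · rintro ⟨b, y⟩
      refine Prod.ext ?_ ?_ <;> simp
  bijective_sq := by
    refine Function.bijective_iff_has_inverse.mpr
      ⟨fun w => ((w.1 - (w.2 - Φ.toFun 0), w.2 - Φ.toFun 0) : ZMod p × ZMod p), ?_, ?_⟩
    · rintro ⟨b, y⟩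
      refine Prod.ext ?_ ?_ <;> simp
    · rintro ⟨b, y⟩
      refine Prod.ext ?_ ?_ <;> simp

end EvenNonconst

/-! Indecomposability makes 𝒢(X) a transitive `p`-group on `p ^ 2` points. The orbits of a central
element of order `p` are blocks, which gives coordinates with `(a, x) · (b, y) = (b + c x a, y + F x
a b)` (`exists_equiv_zmod_prod`). The cycle set law becomes two identities, each saying that some
expression is symmetric under exchanging `(a, x)` and `(b, y)`.

A function on `ZMod p` has a degree, measured by iterated differences, and the symmetry turns degree
bounds in `y` into degree bounds in `x`. When `c` is not constant on fibres, its leading coefficient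
in `x` is a constant (`leading_const`). After a translation of each fibre, `F x a d` depends only on
`d - a` (`snd_eq_of_normalized`) and `c` is linear in `x` (`degree_eq_zero_of_normalized`). With `c`
itself as fibre coordinate the operation is that of a model (`exists_even`). Irretractability
excludes the degenerate cases: `c` constant on fibres, normalized `F` zero, `Φ` constant.

Injective homomorphisms between models are affine (`exists_affine_of_isHom`); this gives both the
uniqueness of `Φ` and the automorphisms. -/

namespace WreathData

/-! ### Finite differences on `ZMod p` as a notion of degree. -/

/-- The forward difference operator on functions `ZMod p → M`. -/
def diff (p : ℕ) (M : Type*) [AddCommGroup M] [Module (ZMod p) M] :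
    Module.End (ZMod p) (ZMod p → M) where
  toFun f x := f (x + 1) - f x
  map_add' f g := by funext x; simp only [Pi.add_apply]; abel
  map_smul' r f := by funext x; simp [smul_sub]

section diff

variable {p : ℕ} {M N : Type*} [AddCommGroup M] [Module (ZMod p) M] [AddCommGroup N]
  [Module (ZMod p) N]

lemma diff_apply (f : ZMod p → M) (x : ZMod p) : diff p M f x = f (x + 1) - f x := rfl

lemma diff_pow_succ_apply (n : ℕ) (f : ZMod p → M) :
    (diff p M ^ (n + 1)) f = diff p M ((diff p M ^ n) f) := by
  rw [pow_succ']; rfl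

lemma diff_pow_comp (ℓ : M →ₗ[ZMod p] N) (n : ℕ) (w : ZMod p → M) :
    (diff p N ^ n) (fun b => ℓ (w b)) = fun b => ℓ ((diff p M ^ n) w b) := by
  induction n with
  | zero => rfl
  | succ n ih =>
    rw [diff_pow_succ_apply, ih, diff_pow_succ_apply]
    funext x
    simp [diff_apply]

lemma diff_pow_eval {ι : Type*} (n : ℕ) (w : ZMod p → ι → M) (i : ι) (x : ZMod p) :
    (diff p M ^ n) (fun x => w x i) x = (diff p (ι → M) ^ n) w x i :=
  congrFun (diff_pow_comp (LinearMap.proj (R := ZMod p) (φ := fun _ : ι => M) i) n w) x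

lemma diff_pow_shift (n : ℕ) (w : ZMod p → M) (k x : ZMod p) :
    (diff p M ^ n) (fun x => w (x + k)) x = (diff p M ^ n) w (x + k) := by
  induction n generalizing x with
  | zero => rfl
  | succ n ih =>
    rw [diff_pow_succ_apply, diff_pow_succ_apply, diff_apply, diff_apply, ih, ih, add_right_comm]

lemma diff_pow_sub (n : ℕ) (f g : ZMod p → M) (x : ZMod p) :
    (diff p M ^ n) (fun x => f x - g x) x = (diff p M ^ n) f x - (diff p M ^ n) g x :=
  congrFun (map_sub (diff p M ^ n) f g) x

lemma diff_pow_succ_const (n : ℕ) (m : M) : (diff p M ^ (n + 1)) (fun _ => m) = 0 := by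
  have h : diff p M (fun _ => m) = 0 := by funext x; simp [diff_apply]
  rw [pow_succ, Module.End.mul_apply, h, map_zero]

lemma diff_pow_eq_zero_of_le {m n : ℕ} (h : m ≤ n) {f : ZMod p → M}
    (hf : (diff p M ^ m) f = 0) : (diff p M ^ n) f = 0 := by
  obtain ⟨k, rfl⟩ := Nat.exists_eq_add_of_le h
  rw [add_comm, pow_add, Module.End.mul_apply, hf, map_zero]

lemma diff_pow_comm (m n : ℕ) (S : ZMod p → ZMod p → M) (x y : ZMod p) :
    (diff p M ^ m) (fun x => (diff p M ^ n) (fun y => S x y) y) x =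
      (diff p M ^ n) (fun y => (diff p M ^ m) (fun x => S x y) x) y := by
  have h := congrFun (diff_pow_comp
    ((LinearMap.proj (R := ZMod p) (φ := fun _ : ZMod p => M) y).comp (diff p M ^ n)) m S) x
  refine h.trans ?_
  change (diff p M ^ n) ((diff p (ZMod p → M) ^ m) S x) y = _
  have h' : (diff p (ZMod p → M) ^ m) S x = fun y => (diff p M ^ m) (fun x => S x y) x :=
    funext fun y => (diff_pow_eval m S y x).symm
  rw [h']

variable [Fact p.Prime]

/-- In the binomial expansion of (shift − 1)^p the inner coefficients are divisible by `p`, and the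
two outer terms cancel because shifting `p` times is the identity. -/
lemma diff_pow_char (f : ZMod p → M) : (diff p M ^ p) f = 0 := by
  have hp : p.Prime := Fact.out
  funext x
  have h : ∀ n : ℕ, (diff p M ^ n) f = (fwdDiff (1 : ZMod p))^[n] f := by
    intro n
    induction n with
    | zero => rfl
    | succ n ih => rw [diff_pow_succ_apply, ih, Function.iterate_succ_apply']; rfl
  rw [h, fwdDiff_iter_eq_sum_shift, Finset.sum_range_succ, Finset.sum_range_eq_add_Ico _ hp.pos,
    Finset.sum_eq_zero (s := Finset.Ico 1 p)]
  · rcases hp.eq_two_or_odd' with rfl | ho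
    · have h2 : (2 : ZMod 2) = 0 := CharTwo.two_eq_zero
      have : f x + f x = 0 := by
        rw [← two_smul (ZMod 2) (f x), h2, zero_smul]
      simpa [h2] using this
    · simp [ho.neg_one_pow]
  · intro k hk
    rw [Finset.mem_Ico] at hk
    obtain ⟨q, hq⟩ := hp.dvd_choose_self (by omega) hk.2
    rw [hq, ← Int.cast_smul_eq_zsmul (ZMod p)]
    simp

lemma exists_degree {f : ZMod p → M} (hf : f ≠ 0) :
    ∃ n, (diff p M ^ n) f ≠ 0 ∧ (diff p M ^ (n + 1)) f = 0 := by
  classical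
  have hex : ∃ n, (diff p M ^ n) f = 0 := ⟨p, diff_pow_char f⟩
  have h0 : Nat.find hex ≠ 0 := by
    intro h
    have := Nat.find_spec hex
    rw [h] at this
    exact hf this
  obtain ⟨n, hn⟩ := Nat.exists_eq_succ_of_ne_zero h0
  refine ⟨n, Nat.find_min hex (by omega), ?_⟩
  have := Nat.find_spec hex
  rwa [hn] at this

lemma eq_affine_of_diff_eq_const {f : ZMod p → M} {e : M} (h : diff p M f = fun _ => e)
    (x : ZMod p) : f x = x • e + f 0 := by
  have key : ∀ n : ℕ, f n = (n : ZMod p) • e + f 0 := by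
    intro n
    induction n with
    | zero => simp
    | succ n ih =>
      have := congrFun h n
      rw [diff_apply, sub_eq_iff_eq_add] at this
      rw [Nat.cast_succ, this, ih, add_smul, one_smul]
      abel
  simpa using key x.val

lemma eq_const_of_diff_eq_zero {f : ZMod p → M} (h : diff p M f = 0) : f = fun _ => f 0 := by
  funext x
  simpa using eq_affine_of_diff_eq_const (e := (0 : M)) h x

/-- The last nonzero iterated difference has zero difference, so it is constant: `n` is the degree
of `f` and `e` its leading coefficient up to a factorial. -/
lemma exists_leading {f : ZMod p → M} (hf : f ≠ 0) :
    ∃ (n : ℕ) (e : M), e ≠ 0 ∧ (diff p M ^ n) f = fun _ => e := by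
  obtain ⟨n, hn, hn1⟩ := exists_degree hf
  rw [diff_pow_succ_apply] at hn1
  have h := eq_const_of_diff_eq_zero hn1
  refine ⟨n, _, ?_, h⟩
  intro h0
  apply hn
  rw [h, h0]
  rfl

lemma exists_leading_of_nonconst {f : ZMod p → M} {x y : ZMod p} (hf : f x ≠ f y) :
    ∃ (n : ℕ) (e : M), e ≠ 0 ∧ (diff p M ^ (n + 1)) f = fun _ => e := by
  have h : diff p M f ≠ 0 := by
    intro h
    rw [eq_const_of_diff_eq_zero h] at hf
    exact hf rfl
  obtain ⟨n, e, he, hn⟩ := exists_leading h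
  exact ⟨n, e, he, by rwa [pow_succ]⟩

lemma diff_pow_eq_affine {f : ZMod p → M} {n : ℕ} {e : M}
    (h : (diff p M ^ (n + 1)) f = fun _ => e) (x : ZMod p) :
    (diff p M ^ n) f x = x • e + (diff p M ^ n) f 0 := by
  rw [diff_pow_succ_apply] at h
  exact eq_affine_of_diff_eq_const h x

/-- If `q` had degree `n + 1` with leading constant `e`, then Δ^n in `b` would turn `q (b + c i) - q
b` into `e * c i`, forcing `e * ℓ c = 0`. -/
lemma eq_of_functional {ι : Type*} (ℓ : (ι → ZMod p) →ₗ[ZMod p] ZMod p) (c : ι → ZMod p)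
    (q : ZMod p → ZMod p) (hc : ℓ c ≠ 0) (h : ∀ b, ℓ (fun i => q (b + c i) - q b) = 0)
    (a b : ZMod p) : q a = q b := by
  by_contra hab
  obtain ⟨n, e, he, hn⟩ := exists_leading_of_nonconst hab
  have h1 := congrFun (diff_pow_comp ℓ n (fun b i => q (b + c i) - q b)) 0
  have h2 : (diff p (ι → ZMod p) ^ n) (fun b i => q (b + c i) - q b) 0 = e • c := by
    funext i
    rw [← diff_pow_eval, diff_pow_sub, diff_pow_shift, diff_pow_eq_affine hn (0 + c i),
      diff_pow_eq_affine hn 0]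
    simp [mul_comm]
  rw [h2, map_smul] at h1
  have h3 : (fun b => ℓ (fun i => q (b + c i) - q b)) = 0 := funext h
  rw [h3, map_zero] at h1
  exact (mul_ne_zero he hc) h1.symm

end diff

end WreathData

/-! ### The cycle set law in wreath coordinates, and the case of constant `c`. -/

namespace WreathData

/-- The maps `(a, x) · (b, y) = (b + c x a, y + F x a b)` satisfy the cycle set equation. -/
structure IsCycleData {p : ℕ} (c : ZMod p → ZMod p → ZMod p)
    (F : ZMod p → ZMod p → ZMod p → ZMod p) : Prop where
  symm_fst : ∀ a x b y, c x a + c (y + F x a b) (b + c x a) =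
    c y b + c (x + F y b a) (a + c y b)
  symm_snd : ∀ a x b y d, F x a d + F (y + F x a b) (b + c x a) (d + c x a) =
    F y b d + F (x + F y b a) (a + c y b) (d + c y b)

namespace IsCycleData

variable {p : ℕ} {c : ZMod p → ZMod p → ZMod p} {F : ZMod p → ZMod p → ZMod p → ZMod p}

lemma diff_pow_eval₂ (n : ℕ) (F : ZMod p → ZMod p → ZMod p → ZMod p) (x a d : ZMod p) :
    (diff p (ZMod p) ^ n) (fun x => F x a d) x = (diff p (ZMod p → ZMod p → ZMod p) ^ n) F x a d := by
  rw [← diff_pow_eval, ← diff_pow_eval]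

lemma diff_pow_fst (n : ℕ) (c : ZMod p → ZMod p → ZMod p) (y s b b' : ZMod p) :
    (diff p (ZMod p) ^ n) (fun y => c (y + s) b' - c y b) y =
      (diff p (ZMod p → ZMod p) ^ n) c (y + s) b' - (diff p (ZMod p → ZMod p) ^ n) c y b := by
  rw [diff_pow_sub, diff_pow_shift n (fun y => c y b'), diff_pow_eval, diff_pow_eval]

lemma diff_pow_snd (n : ℕ) (F : ZMod p → ZMod p → ZMod p → ZMod p) (y s b b' d d' : ZMod p) :
    (diff p (ZMod p) ^ n) (fun y => F (y + s) b' d' - F y b d) y =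
      (diff p (ZMod p → ZMod p → ZMod p) ^ n) F (y + s) b' d' -
        (diff p (ZMod p → ZMod p → ZMod p) ^ n) F y b d := by
  rw [diff_pow_sub, diff_pow_shift n (fun y => F y b' d'), diff_pow_eval₂, diff_pow_eval₂]

lemma sub_fst (h : IsCycleData c F) (a x b y : ZMod p) :
    c (y + F x a b) (b + c x a) - c y b = c (x + F y b a) (a + c y b) - c x a := by
  linear_combination h.symm_fst a x b y

lemma sub_snd (h : IsCycleData c F) (a x b y d : ZMod p) :
    F (y + F x a b) (b + c x a) (d + c x a) - F y b d =
      F (x + F y b a) (a + c y b) (d + c y b) - F x a d := by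
  linear_combination h.symm_snd a x b y d

variable [Fact p.Prime]

/-- By `sub_snd` the expression is symmetric in the two points, so a degree bound in `y`, valid for
all parameters, is also one in `x`. -/
lemma diff_pow_snd_left_eq_zero (h : IsCycleData c F) {n : ℕ}
    (hn : ∀ a x b y d, (diff p (ZMod p) ^ n)
      (fun y => F (y + F x a b) (b + c x a) (d + c x a) - F y b d) y = 0) (a x b y d : ZMod p) :
    (diff p (ZMod p) ^ n)
      (fun x => F (y + F x a b) (b + c x a) (d + c x a) - F y b d) x = 0 := by
  rw [← hn b y a x d]
  exact congrFun (congrArg _ (funext fun x => h.sub_snd a x b y d)) x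

lemma diff_pow_fst_left_eq_zero (h : IsCycleData c F) {n : ℕ}
    (hn : ∀ a x b y, (diff p (ZMod p) ^ n)
      (fun y => c (y + F x a b) (b + c x a) - c y b) y = 0) (a x b y : ZMod p) :
    (diff p (ZMod p) ^ n) (fun x => c (y + F x a b) (b + c x a) - c y b) x = 0 := by
  rw [← hn b y a x]
  exact congrFun (congrArg _ (funext fun x => h.sub_fst a x b y)) x

/-- The degree of `F` in the fibre coordinate cannot be positive once its leading coefficient is
invariant under translations. -/
lemma false_of_invariant_leading (h : IsCycleData c F) {t : ℕ} {B : ZMod p → ZMod p → ZMod p}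
    (hB0 : B ≠ 0) (hF : (diff p (ZMod p → ZMod p → ZMod p) ^ (t + 1)) F = fun _ => B)
    (hB : ∀ b d k, B (b + k) (d + k) = B b d)
    (hQ : ∀ a b d x, (diff p (ZMod p) ^ (t + 1))
      (fun x => (diff p (ZMod p → ZMod p → ZMod p) ^ t) F 0 (b + c x a) (d + c x a)) x = 0) :
    False := by
  have h1 := h.diff_pow_snd_left_eq_zero (n := t + 1) (fun a x b y d => by
    rw [diff_pow_snd, hF]
    simp [hB])
  -- Apply Δ^t in `y` and Δ^(t+1) in `x`: only the product of the two leading coefficients survives.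
  have h2 : ∀ a b d, B a b * B b d = 0 := by
    intro a b d
    have h3 := diff_pow_comm (t + 1) t
      (fun x y => F (y + F x a b) (b + c x a) (d + c x a) - F y b d) 0 0
    simp only [h1] at h3
    rw [show (fun _ : ZMod p => (0 : ZMod p)) = 0 from rfl, map_zero] at h3
    simp only [diff_pow_snd] at h3
    have h4 : (fun x : ZMod p => (diff p (ZMod p → ZMod p → ZMod p) ^ t) F (0 + F x a b)
        (b + c x a) (d + c x a) - (diff p (ZMod p → ZMod p → ZMod p) ^ t) F 0 b d) =
        B b d • (fun x => F x a b) + ((fun x => (diff p (ZMod p → ZMod p → ZMod p) ^ t) F 0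
        (b + c x a) (d + c x a)) - fun _ => (diff p (ZMod p → ZMod p → ZMod p) ^ t) F 0 b d) := by
      funext x
      rw [diff_pow_eq_affine hF]
      simp [hB]
      ring
    rw [h4, map_add, map_smul, map_sub, diff_pow_succ_const] at h3
    simp only [Pi.add_apply, Pi.smul_apply, Pi.sub_apply, hQ, diff_pow_eval₂, hF] at h3
    simpa [mul_comm] using h3
  have h5 : ∃ a d, B a d ≠ 0 := by
    by_contra! h5
    exact hB0 (by funext a d; exact h5 a d)
  obtain ⟨a, d, hne⟩ := h5
  -- The third point continues the progression `a, d`, so invariance makes both factors equal to `B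
  -- a d`.
  have h6 := h2 a d (d + (d - a))
  rw [show B d (d + (d - a)) = B a d by
    rw [← hB a d (d - a)]; congr 1; ring] at h6
  exact hne (mul_self_eq_zero.mp h6)

section constant

variable {k : ZMod p}

/-- Descent: passing to the points `x + F y a a`, `y + F x a a` over `a + k` keeps the difference of
the `F`-values and lowers the difference of the points by it. After `m` steps the points coincide.
-/
lemma diag_eq_of_const (h : IsCycleData (fun _ _ => k) F) (x y a : ZMod p) :
    F x a a = F y a a := by
  have key : ∀ (m : ℕ) (a x y : ZMod p), x - y = m * (F x a a - F y a a) → F x a a = F y a a := by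
    intro m
    induction m with
    | zero =>
      intro a x y hxy
      rw [Nat.cast_zero, zero_mul, sub_eq_zero] at hxy
      rw [hxy]
    | succ m ih =>
      intro a x y hxy
      have h1 := h.symm_snd a x a y a
      have h2 := ih (a + k) (x + F y a a) (y + F x a a) (by
        push_cast at hxy
        linear_combination hxy + m * h1)
      rw [h2] at h1
      exact add_right_cancel h1
  by_contra hne
  have hne' := sub_ne_zero.mpr hne
  refine hne (key ((x - y) / (F x a a - F y a a)).val a x y ?_)
  rw [ZMod.natCast_zmod_val, div_mul_cancel₀ _ hne']

/-- If `c` is a nonzero constant then `F` does not depend on the fibre coordinate. -/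
lemma snd_eq_of_const (h : IsCycleData (fun _ _ => k) F) (hk : k ≠ 0) (x y : ZMod p) :
    F x = F y := by
  by_contra hne
  obtain ⟨t, B, hB0, hF⟩ := exists_leading_of_nonconst hne
  have hBk : ∀ b d, B (b + k) (d + k) = B b d := by
    intro a d
    -- By symmetry the left side depends on `y` only through `F y a a`, which does not vary with
    -- `y`; hence its differences vanish.
    have h1 : ∀ y, F (y + F 0 a a) (a + k) (d + k) - F y a d =
        F (0 + F 0 a a) (a + k) (d + k) - F 0 a d := by
      intro y
      rw [h.sub_snd a 0 a y d, h.diag_eq_of_const y 0 a]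
    have h2 := diff_pow_snd (t + 1) F 0 (F 0 a a) a (a + k) d (d + k)
    simp only [h1, diff_pow_succ_const, hF] at h2
    exact (sub_eq_zero.mp h2.symm)
  refine h.false_of_invariant_leading hB0 hF ?_ ?_
  · intro b d k'
    have := eq_of_functional (LinearMap.proj (R := ZMod p) (φ := fun _ : Unit => ZMod p) ())
      (fun _ => k) (fun b' => B b' (b' + (d - b))) hk (fun b' => by
        simp only [LinearMap.proj_apply]
        rw [← hBk b', sub_eq_zero]
        congr 1; ring) (b + k') b
    convert this using 2 <;> ring
  · intro a b d x
    rw [diff_pow_succ_const]; rfl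

end constant

end IsCycleData

end WreathData

/-! ### Degree comparison when `c` varies along fibres. -/

namespace WreathData

namespace IsCycleData

variable {p : ℕ} [Fact p.Prime] {c : ZMod p → ZMod p → ZMod p}
  {F : ZMod p → ZMod p → ZMod p → ZMod p}

/-- The same descent as in `diag_eq_of_const`, now on base coordinates: the difference of the
`c`-values persists while `a - b` drops by it. -/
lemma const_of_const_on_fibres (h : IsCycleData c F) (hc : ∀ a x y, c x a = c y a)
    (a x b y : ZMod p) : c x a = c y b := by
  have key : ∀ (m : ℕ) (a x b y : ZMod p), a - b = m * (c x a - c y b) → c x a = c y b := by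
    intro m
    induction m with
    | zero =>
      intro a x b y hab
      rw [Nat.cast_zero, zero_mul, sub_eq_zero] at hab
      rw [hab, hc]
    | succ m ih =>
      intro a x b y hab
      have h1 := h.symm_fst a x b y
      have h2 := ih (a + c y b) (x + F y b a) (b + c x a) (y + F x a b) (by
        push_cast at hab
        linear_combination hab + m * h1)
      rw [h2] at h1
      exact add_right_cancel h1
  by_contra hne
  have hne' := sub_ne_zero.mpr hne
  refine hne (key ((a - b) / (c x a - c y b)).val a x b y ?_)
  rw [ZMod.natCast_zmod_val, div_mul_cancel₀ _ hne']

/-- Otherwise let `E` have degree `s + 1`. The functional `ℓ` = Δ_a^(s+1) Δ_x^(n+1) is nonzero on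
`c`. It kills `E (b + c x a) - E b`: this is Δ_y^(n+1) of the expression in `sub_fst`, whose other
form is sent by Δ_x^(n+1) to `E (a + c y b) - E a`, which Δ_a^(s+1) kills. -/
lemma leading_const (h : IsCycleData c F) {n : ℕ} {E : ZMod p → ZMod p}
    (hE : (diff p (ZMod p → ZMod p) ^ (n + 1)) c = fun _ => E) (a b : ZMod p) : E a = E b := by
  by_contra hne
  obtain ⟨s, ε, hε, hs⟩ := exists_leading_of_nonconst hne
  let ℓ : (ZMod p × ZMod p → ZMod p) →ₗ[ZMod p] ZMod p :=
    (LinearMap.proj (R := ZMod p) (φ := fun _ : ZMod p => ZMod p) 0) ∘ₗ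
      (diff p (ZMod p) ^ (n + 1)) ∘ₗ
      (LinearMap.proj (R := ZMod p) (φ := fun _ : ZMod p => ZMod p → ZMod p) 0) ∘ₗ
      (diff p (ZMod p → ZMod p) ^ (s + 1)) ∘ₗ
      (LinearEquiv.curry (ZMod p) (ZMod p) (ZMod p) (ZMod p)).toLinearMap
  have hℓ : ∀ g, ℓ g = (diff p (ZMod p) ^ (s + 1))
      (fun a => (diff p (ZMod p) ^ (n + 1)) (fun x => g (a, x)) 0) 0 := fun g =>
    (congrFun (diff_pow_comp
      ((LinearMap.proj (R := ZMod p) (φ := fun _ : ZMod p => ZMod p) 0) ∘ₗ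
        (diff p (ZMod p) ^ (n + 1))) (s + 1) (fun a x => g (a, x))) 0).symm
  refine hne (eq_of_functional ℓ (fun u => c u.2 u.1) E ?_ ?_ a b)
  · rw [hℓ]
    simp only [diff_pow_eval, hE]
    change (diff p (ZMod p) ^ (s + 1)) E 0 ≠ 0
    rwa [hs]
  · intro b
    have h1 := congrFun (diff_pow_comp ℓ (n + 1)
      (fun y u => c (y + F u.2 u.1 b) (b + c u.2 u.1) - c y b)) 0
    have h2 : (diff p (ZMod p × ZMod p → ZMod p) ^ (n + 1))
        (fun y u => c (y + F u.2 u.1 b) (b + c u.2 u.1) - c y b) 0 =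
        fun u => E (b + c u.2 u.1) - E b := by
      funext u
      rw [← diff_pow_eval, diff_pow_fst, hE]
    have h3 : (fun y => ℓ (fun u => c (y + F u.2 u.1 b) (b + c u.2 u.1) - c y b)) = 0 := by
      funext y
      rw [hℓ]
      simp only [h.sub_fst _ _ b y, diff_pow_fst, hE]
      rw [diff_pow_sub, diff_pow_shift, hs]
      simp
    rw [h2, h3, map_zero] at h1
    exact h1.symm

lemma diff_pow_snd_at_zero (F : ZMod p → ZMod p → ZMod p → ZMod p) {t : ℕ}
    {B : ZMod p → ZMod p → ZMod p}
    (hF : (diff p (ZMod p → ZMod p → ZMod p) ^ (t + 1)) F = fun _ => B)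
    (s b b' d d' : ZMod p) :
    (diff p (ZMod p) ^ t) (fun y => F (y + s) b' d' - F y b d) 0 =
      s * B b' d' + ((diff p (ZMod p → ZMod p → ZMod p) ^ t) F 0 b' d' -
        (diff p (ZMod p → ZMod p → ZMod p) ^ t) F 0 b d) := by
  rw [diff_pow_snd, diff_pow_eq_affine hF]
  simp
  ring

lemma diff_pow_comm_eq_zero {m : ℕ} {S : ZMod p → ZMod p → ZMod p}
    (hS : ∀ x y, (diff p (ZMod p) ^ m) (fun x => S x y) x = 0) (k : ℕ) (x y : ZMod p) :
    (diff p (ZMod p) ^ m) (fun x => (diff p (ZMod p) ^ k) (fun y => S x y) y) x = 0 := by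
  rw [diff_pow_comm]
  simp only [hS]
  rw [show (fun _ : ZMod p => (0 : ZMod p)) = 0 from rfl, map_zero]
  rfl

lemma fst_leading_ne_zero {n : ℕ} {e : ZMod p} (he : e ≠ 0)
    (hc : (diff p (ZMod p → ZMod p) ^ (n + 1)) c = fun _ _ => e) (a : ZMod p) :
    ((LinearMap.proj (R := ZMod p) (φ := fun _ : ZMod p => ZMod p) 0) ∘ₗ
      (diff p (ZMod p) ^ (n + 1))) (fun x => c x a) ≠ 0 := by
  change (diff p (ZMod p) ^ (n + 1)) (fun x => c x a) 0 ≠ 0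
  rwa [diff_pow_eval, hc]

/-- `eq_of_functional` along each diagonal `d - b`, with Δ^(n+1) at 0 as the functional: it does not
vanish on `x ↦ c x 0`. -/
lemma invariant_of_diff_pow_eq_zero {n : ℕ} {e : ZMod p} (he : e ≠ 0)
    (hc : (diff p (ZMod p → ZMod p) ^ (n + 1)) c = fun _ _ => e)
    {G : ZMod p → ZMod p → ZMod p}
    (hG : ∀ a b d, (diff p (ZMod p) ^ (n + 1))
      (fun x => G (b + c x a) (d + c x a) - G b d) 0 = 0) (b d k : ZMod p) :
    G (b + k) (d + k) = G b d := by
  have := eq_of_functional _ (fun x => c x 0) (fun b' => G b' (b' + (d - b)))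
    (fst_leading_ne_zero he hc 0) (fun b' => by
      refine Eq.trans ?_ (hG 0 b' (b' + (d - b)))
      exact congrArg (fun f => (diff p (ZMod p) ^ (n + 1)) f 0) (funext fun x => by
        rw [add_right_comm b' (c x 0) (d - b)])) (b + k) b
  convert this using 2 <;> ring

section normalized

variable {n : ℕ} {e : ZMod p}

lemma diff_pow_fst_eq_zero (h : IsCycleData c F)
    (hc : (diff p (ZMod p → ZMod p) ^ n) c = fun x _ => x * e) (a x b y : ZMod p) :
    (diff p (ZMod p) ^ (n + 1)) (fun x => c (y + F x a b) (b + c x a) - c y b) x = 0 := by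
  refine h.diff_pow_fst_left_eq_zero (fun a x b y => ?_) a x b y
  rw [diff_pow_fst, diff_pow_succ_apply, hc]
  simp [diff_apply, add_mul]

/-- Δ^n in `y` turns the expression of `diff_pow_fst_eq_zero` into `e * F x a b`, which inherits its
degree bound in `x`. -/
lemma diff_pow_snd_eq_zero (h : IsCycleData c F) (he : e ≠ 0)
    (hc : (diff p (ZMod p → ZMod p) ^ n) c = fun x _ => x * e) :
    (diff p (ZMod p → ZMod p → ZMod p) ^ (n + 1)) F = 0 := by
  funext x a b
  have h1 := diff_pow_comm_eq_zero (S := fun x y => c (y + F x a b) (b + c x a) - c y b)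
    (fun x y => h.diff_pow_fst_eq_zero hc a x b y) n x 0
  simp only [diff_pow_fst, hc] at h1
  have h2 : (fun x => (0 + F x a b) * e - 0 * e) = e • fun x => F x a b := by
    funext x
    simp [mul_comm]
  rw [h2, map_smul, Pi.smul_apply, diff_pow_eval₂, smul_eq_mul] at h1
  exact (mul_eq_zero.mp h1).resolve_left he

/-- The leading coefficient `B` of `F` in the fibre coordinate is translation invariant. In positive
degree so is the next coefficient, since the extra term `F x a b * B b d` is killed by Δ^(n+1);
`false_of_invariant_leading` then applies. -/
lemma snd_eq_of_normalized (h : IsCycleData c F) (he : e ≠ 0) (hF0 : F ≠ 0)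
    (hc : (diff p (ZMod p → ZMod p) ^ n) c = fun x _ => x * e) (x a d : ZMod p) :
    F x a d = F 0 0 (d - a) := by
  have hc1 : (diff p (ZMod p → ZMod p) ^ (n + 1)) c = fun _ _ => e := by
    rw [diff_pow_succ_apply, hc]
    funext x a
    simp [diff_apply, add_mul]
  have hFn := h.diff_pow_snd_eq_zero he hc
  obtain ⟨t, B, hB0, hB⟩ := exists_leading hF0
  have htn : t + 1 ≤ n + 1 := by
    by_contra htn
    have := diff_pow_eq_zero_of_le (show n + 1 ≤ t by omega) hFn
    rw [hB] at this
    exact hB0 (congrFun this 0)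
  have hSt := h.diff_pow_snd_left_eq_zero (n := t + 1) (fun a x b y d => by
    rw [diff_pow_snd, diff_pow_succ_apply, hB]
    simp [diff_apply])
  have hS : ∀ a x b y d, (diff p (ZMod p) ^ (n + 1))
      (fun x => F (y + F x a b) (b + c x a) (d + c x a) - F y b d) x = 0 := fun a x b y d =>
    congrFun (diff_pow_eq_zero_of_le htn (funext fun x => hSt a x b y d)) x
  have hBinv : ∀ b d k, B (b + k) (d + k) = B b d :=
    invariant_of_diff_pow_eq_zero he hc1 (fun a b d => by
      have h1 := diff_pow_comm_eq_zero (fun x y => hS a x b y d) t 0 0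
      simpa only [diff_pow_snd, hB] using h1)
  cases t with
  | zero =>
    rw [pow_zero, Module.End.one_apply] at hB
    rw [hB]
    have := hBinv 0 (d - a) a
    rwa [zero_add, sub_add_cancel] at this
  | succ t =>
    exfalso
    refine h.false_of_invariant_leading hB0 hB hBinv ?_
    have hQ := invariant_of_diff_pow_eq_zero he hc1
      (G := (diff p (ZMod p → ZMod p → ZMod p) ^ t) F 0) (fun a b d => by
      have h1 := diff_pow_comm_eq_zero (fun x y => hS a x b y d) t 0 0
      simp only [diff_pow_snd_at_zero F hB, hBinv] at h1
      have h2 : ∀ g : ZMod p → ZMod p, (fun x => F x a b * B b d + g x) =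
          B b d • (fun x => F x a b) + g := by
        intro g
        funext x
        simp [mul_comm]
      rw [h2, map_add, map_smul, Pi.add_apply, Pi.smul_apply, diff_pow_eval₂, hFn] at h1
      simpa using h1)
    intro a b d x
    simp only [hQ]
    rw [diff_pow_succ_const]
    rfl

lemma degree_eq_zero_of_normalized (h : IsCycleData c F) (he : e ≠ 0) (hF0 : F ≠ 0)
    (hc : (diff p (ZMod p → ZMod p) ^ n) c = fun x _ => x * e) : n = 0 := by
  have hc1 : (diff p (ZMod p → ZMod p) ^ (n + 1)) c = fun _ _ => e := by
    rw [diff_pow_succ_apply, hc]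
    funext x a
    simp [diff_apply, add_mul]
  have hF := h.snd_eq_of_normalized he hF0 hc
  -- The leading coefficient `q` in `x` of `c x a - c x 0` is constant by `eq_of_functional`, and it
  -- vanishes at `a = 0`.
  have hca : ∀ x a, c x a = c x 0 := by
    by_contra hne
    have hg : (fun x a => c x a - c x 0) ≠ 0 := by
      intro hg
      exact hne fun x a => sub_eq_zero.mp (congrFun (congrFun hg x) a)
    obtain ⟨m, q, hq0, hq⟩ := exists_leading hg
    have hmc : ∀ x a, (diff p (ZMod p → ZMod p) ^ m) c x a =
        (diff p (ZMod p → ZMod p) ^ m) c x 0 + q a := by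
      intro x a
      have := diff_pow_eval m (fun x a => c x a - c x 0) a x
      rw [hq, diff_pow_sub, diff_pow_eval, diff_pow_eval] at this
      exact sub_eq_iff_eq_add'.mp this
    have hqc := eq_of_functional _ (fun x => c x 0) q (fst_leading_ne_zero he hc1 0) (fun b => by
      have h1 := diff_pow_comm_eq_zero (S := fun x y => c (y + F x 0 b) (b + c x 0) - c y b)
        (fun x y => h.diff_pow_fst_eq_zero hc 0 x b y) m 0 0
      simp only [diff_pow_fst, hF _ 0 b] at h1
      simp only [LinearMap.comp_apply, LinearMap.proj_apply]
      have h2 : ∀ x, (diff p (ZMod p → ZMod p) ^ m) c (0 + F 0 0 (b - 0)) (b + c x 0) -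
          (diff p (ZMod p → ZMod p) ^ m) c 0 b = (q (b + c x 0) - q b) +
          ((diff p (ZMod p → ZMod p) ^ m) c (0 + F 0 0 (b - 0)) 0 -
          (diff p (ZMod p → ZMod p) ^ m) c 0 0) := by
        intro x
        rw [hmc _ (b + c x 0), hmc _ b]
        ring
      simp only [h2] at h1
      have h3 := map_add (diff p (ZMod p) ^ (n + 1)) (fun x => q (b + c x 0) - q b)
        (fun _ => (diff p (ZMod p → ZMod p) ^ m) c (0 + F 0 0 (b - 0)) 0 -
          (diff p (ZMod p → ZMod p) ^ m) c 0 0)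
      rw [diff_pow_succ_const, add_zero] at h3
      rw [← h3]
      exact h1)
    apply hq0
    funext a
    have := hmc 0 0
    rw [left_eq_add] at this
    rw [hqc a 0, this]
    rfl
  by_contra hn
  obtain ⟨n, rfl⟩ := Nat.exists_eq_succ_of_ne_zero hn
  apply hF0
  funext x a d
  rw [hF]
  -- The symmetric form shows no dependence on `y`. For positive degree Δ^n in `y` therefore gives
  -- 0, but it also gives `F * e`, forcing `F = 0`.
  have h1 : ∀ y, c (y + F 0 a d) (d + c 0 a) - c y d = c (0 + F 0 a d) (d + c 0 a) - c 0 d := by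
    intro y
    rw [h.sub_fst a 0 d y, h.sub_fst a 0 d 0, hca _ (a + c y d), hca _ (a + c 0 d), hF y d a,
      hF 0 d a]
  have h2 := diff_pow_fst (n + 1) c 0 (F 0 a d) d (d + c 0 a)
  simp only [h1, diff_pow_succ_const] at h2
  rw [Nat.succ_eq_add_one] at hc
  rw [hc, hF] at h2
  have h3 : F 0 0 (d - a) * e = 0 := by simpa using h2.symm
  simpa [he] using h3

end normalized

end IsCycleData

end WreathData

/-! ### Normalizing the fibre coordinate. -/

namespace WreathData

namespace IsCycleData

variable {p : ℕ} [Fact p.Prime] {c : ZMod p → ZMod p → ZMod p}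
  {F : ZMod p → ZMod p → ZMod p → ZMod p}

/-- The identities transported along the coordinate change `x ↦ x + σ a`. -/
lemma translate (h : IsCycleData c F) (σ : ZMod p → ZMod p) :
    IsCycleData (fun x a => c (x - σ a) a)
      (fun x a d => F (x - σ a) a d + (σ (d + c (x - σ a) a) - σ d)) where
  symm_fst a x b y := by
    have h1 := h.symm_fst a (x - σ a) b (y - σ b)
    convert h1 using 3 <;> ring
  symm_snd a x b y d := by
    have h1 := h.symm_snd a (x - σ a) b (y - σ b) d
    have h2 := h.symm_fst a (x - σ a) b (y - σ b)
    have e1 : ∀ a x b y : ZMod p,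
        y + (F (x - σ a) a b + (σ (b + c (x - σ a) a) - σ b)) - σ (b + c (x - σ a) a) =
          y - σ b + F (x - σ a) a b := by
      intros
      ring
    rw [e1 a x b y, e1 b y a x]
    rw [add_assoc d, add_assoc d, h2]
    linear_combination h1

/-- Coordinates in which the fibre coordinate is the value of `c`. -/
theorem exists_even (h : IsCycleData c F)
    (hirr : Function.Injective fun u : ZMod p × ZMod p => (c u.2 u.1, F u.2 u.1))
    (hc : ∃ x a, c x a ≠ 0) :
    ∃ Φ : EvenNonconst p, (∀ a, Function.Bijective fun x => c x a) ∧
      ∀ a x b y, c (y + F x a b) (b + c x a) = c y b + Φ.toFun (b - a) := by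
  have hp1 : (0 : ZMod p) ≠ 1 := zero_ne_one
  by_cases hfib : ∀ a x y, c x a = c y a
  · exfalso
    obtain ⟨x₀, a₀, hk⟩ := hc
    have hk' : c = fun _ _ => c x₀ a₀ := by
      funext x a
      exact h.const_of_const_on_fibres hfib a x a₀ x₀
    rw [hk'] at h
    have h1 := h.snd_eq_of_const hk 0 1
    have h2 := @hirr ((0 : ZMod p), (0 : ZMod p)) ((0 : ZMod p), (1 : ZMod p))
      (Prod.ext (hfib _ _ _) (congrFun h1 0))
    exact hp1 (congrArg Prod.snd h2)
  · push Not at hfib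
    obtain ⟨a₀, x₀, y₀, hne⟩ := hfib
    obtain ⟨n, E, hE0, hE⟩ := exists_leading_of_nonconst (f := c) (x := x₀) (y := y₀)
      (fun h' => hne (congrFun h' a₀))
    have hEc : E = fun _ => E 0 := funext fun a => h.leading_const hE a 0
    have he : E 0 ≠ 0 := by
      intro h0
      apply hE0
      rw [hEc, h0]
      rfl
    set e := E 0 with hedef
    let s : ZMod p → ZMod p := fun a => (diff p (ZMod p → ZMod p) ^ n) c 0 a
    have hs : ∀ x a, (diff p (ZMod p → ZMod p) ^ n) c x a = x * e + s a := by
      intro x a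
      rw [diff_pow_eq_affine hE, hEc]
      rfl
    -- This shift absorbs the constant term `s a` of Δ^n c, leaving `x * e`.
    let σ : ZMod p → ZMod p := fun a => s a / e
    have h' := h.translate σ
    have hc' : (diff p (ZMod p → ZMod p) ^ n) (fun x a => c (x - σ a) a) =
        fun x _ => x * e := by
      funext x a
      rw [← diff_pow_eval]
      have := diff_pow_shift n (fun x => c x a) (-σ a) x
      simp only [← sub_eq_add_neg] at this
      rw [this, diff_pow_eval, hs, sub_mul, div_mul_cancel₀ _ he, sub_add_cancel]
    have hirr' : ∀ x a y b, c (x - σ a) a = c (y - σ b) b →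
        (∀ d, F (x - σ a) a d + (σ (d + c (x - σ a) a) - σ d) =
          F (y - σ b) b d + (σ (d + c (y - σ b) b) - σ d)) → a = b := by
      intro x a y b h1 h2
      have h3 := @hirr (a, x - σ a) (b, y - σ b) (Prod.ext h1 (funext fun d => by
        have := h2 d
        rw [h1] at this
        exact add_right_cancel this))
      exact congrArg Prod.fst h3
    have hF0 : (fun x a d => F (x - σ a) a d + (σ (d + c (x - σ a) a) - σ d)) ≠ 0 := by
      intro hF0
      have h0 : ∀ x a d, F (x - σ a) a d + (σ (d + c (x - σ a) a) - σ d) = 0 :=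
        fun x a d => congrFun (congrFun (congrFun hF0 x) a) d
      -- If the new `F` vanishes, `c` determines the old one, so irretractability would embed `p ^
      -- 2` points into `p` values.
      have hinj : Function.Injective fun u : ZMod p × ZMod p => c u.2 u.1 := by
        rintro ⟨a, x⟩ ⟨b, y⟩ hab
        refine hirr (Prod.ext hab (funext fun d => ?_))
        have e1 := h0 (x + σ a) a d
        have e2 := h0 (y + σ b) b d
        simp only [add_sub_cancel_right] at e1 e2 hab ⊢
        rw [hab] at e1
        exact add_right_cancel (e1.trans e2.symm)
      have h1 := Fintype.card_le_of_injective _ hinj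
      rw [Fintype.card_prod, ZMod.card] at h1
      nlinarith [(Fact.out : p.Prime).two_le]
    have hn := h'.degree_eq_zero_of_normalized he hF0 hc'
    have hF := h'.snd_eq_of_normalized he hF0 hc'
    subst hn
    rw [pow_zero, Module.End.one_apply] at hc'
    have hlin : ∀ x a, c x a = (x + σ a) * e := by
      intro x a
      have := congrFun (congrFun hc' (x + σ a)) a
      simpa using this
    obtain ⟨φ, hφ⟩ : ∃ φ : ZMod p → ZMod p, ∀ x a d,
        F (x - σ a) a d + (σ (d + c (x - σ a) a) - σ d) = φ (d - a) :=
      ⟨fun A => F (0 - σ 0) 0 A + (σ (A + c (0 - σ 0) 0) - σ A), hF⟩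
    have hmul : ∀ a x b y, c (y + F x a b) (b + c x a) = c y b + φ (b - a) * e := by
      intro a x b y
      have h1 := hφ (x + σ a) a b
      rw [add_sub_cancel_right] at h1
      rw [hlin (y + F x a b), hlin y]
      linear_combination e * h1
    refine ⟨⟨fun A => φ A * e, ?_, ?_⟩, ?_, hmul⟩
    · by_contra! hconst
      have hφc : ∀ A B, φ A = φ B := fun A B => mul_right_cancel₀ he (hconst A B)
      -- For constant `φ` the points `(0, 0)` and `(1, 0)` in the new coordinates would act
      -- identically.
      refine hp1 (hirr' 0 0 0 1 ?_ ?_)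
      · rw [hlin, hlin]
        ring
      · intro d
        rw [hφ, hφ]
        exact hφc _ _
    · intro A
      have h1 := h.symm_fst 0 0 A 0
      rw [hmul, hmul, zero_sub, sub_zero] at h1
      linear_combination h1
    · intro a
      have : (fun x => c x a) = fun x => (x + σ a) * e := funext fun x => hlin x a
      rw [this]
      exact Finite.injective_iff_bijective.mp fun x y hxy =>
        add_right_cancel (mul_right_cancel₀ he hxy)

end IsCycleData

end WreathData

/-! ### Transitive `p`-groups of degree `p` and `p ^ 2`. -/

namespace PGroupAction

variable {p : ℕ} [Fact p.Prime]

/-- A transitive finite `p`-group has a fixed-point-free equivariant permutation of order `p`. -/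
lemma exists_central_perm {G X : Type*} [Group G] [MulAction G X] [Finite X] [Nontrivial X]
    (hG : IsPGroup p G) (htr : ∀ x y : X, ∃ g : G, g • x = y) :
    ∃ z : Equiv.Perm X, z ^ p = 1 ∧ (∀ (g : G) x, z (g • x) = g • z x) ∧ ∀ x, z x ≠ x := by
  let H := (MulAction.toPermHom G X).range
  have hH : IsPGroup p H := hG.of_surjective _ (MulAction.toPermHom G X).rangeRestrict_surjective
  have hHn : Nontrivial H := by
    obtain ⟨x, y, hxy⟩ := exists_pair_ne X
    obtain ⟨g, hg⟩ := htr x y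
    refine ⟨⟨⟨MulAction.toPermHom G X g, g, rfl⟩, 1, ?_⟩⟩
    intro h
    apply hxy
    have := congrArg (fun t : H => (t : Equiv.Perm X) x) h
    rw [← hg]
    exact this.symm
  have := hH.center_nontrivial
  obtain ⟨n, hn⟩ := IsPGroup.iff_card.mp (hH.to_subgroup (Subgroup.center H))
  have hn0 : n ≠ 0 := by
    rintro rfl
    rw [pow_zero] at hn
    exact (Finite.one_lt_card (α := Subgroup.center H)).ne' hn
  obtain ⟨⟨⟨z, hzH⟩, hzc⟩, hz⟩ := exists_prime_orderOf_dvd_card' (G := Subgroup.center H) p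
    (hn ▸ dvd_pow_self p hn0)
  have hcomm : ∀ (g : G) x, z (g • x) = g • z x := by
    intro g x
    have h1 := Subgroup.mem_center_iff.mp hzc ⟨MulAction.toPermHom G X g, g, rfl⟩
    exact (congrArg (fun t : H => (t : Equiv.Perm X) x) h1).symm
  refine ⟨z, ?_, hcomm, ?_⟩
  · have h1 := pow_orderOf_eq_one (⟨⟨z, hzH⟩, hzc⟩ : Subgroup.center H)
    rw [hz] at h1
    exact congrArg (fun t : Subgroup.center H => ((t : H) : Equiv.Perm X)) h1
  · intro x hx
    -- A central permutation with one fixed point fixes everything, by transitivity.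
    have h1 : z = 1 := by
      ext y
      obtain ⟨g, rfl⟩ := htr x y
      rw [hcomm, hx]
      rfl
    subst h1
    have h2 : (⟨⟨1, hzH⟩, hzc⟩ : Subgroup.center H) = 1 := rfl
    rw [h2, orderOf_one] at hz
    exact (Fact.out : p.Prime).one_lt.ne hz

/-- The action of `ZMod p` generated by a permutation of exponent `p`. -/
lemma exists_free_action {X : Type*} {z : Equiv.Perm X} (hz : z ^ p = 1) (hfix : ∀ x, z x ≠ x) :
    ∃ τ : ZMod p → X → X, (∀ x, τ 0 x = x) ∧ (∀ m n x, τ (m + n) x = τ m (τ n x)) ∧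
      (∀ m n x, τ m x = τ n x → m = n) ∧ ∀ g : X → X, (∀ x, z (g x) = g (z x)) →
        ∀ n x, τ n (g x) = g (τ n x) := by
  have hmod : ∀ n : ℕ, z ^ (n % p) = z ^ n := fun n => (pow_mod_orderOf z (n % p)).symm.trans <| by
    rw [Nat.mod_mod_of_dvd n (orderOf_dvd_of_pow_eq_one hz), pow_mod_orderOf]
  have hadd : ∀ (m n : ZMod p) x, (z ^ (m + n).val) x = (z ^ m.val) ((z ^ n.val) x) := by
    intro m n x
    rw [ZMod.val_add, hmod, pow_add]
    rfl
  have h0 : ∀ x, (z ^ (0 : ZMod p).val) x = x := by simp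
  have hfree : ∀ (n : ZMod p) x, (z ^ n.val) x = x → n = 0 := by
    intro n x hx
    by_contra hn
    have h1 : ∀ k : ℕ, (z ^ (k * n : ZMod p).val) x = x := by
      intro k
      induction k with
      | zero => simp
      | succ k ih => rw [Nat.cast_succ, add_mul, one_mul, hadd, hx, ih]
    have h2 := h1 (n⁻¹).val
    rw [ZMod.natCast_zmod_val, inv_mul_cancel₀ hn, ZMod.val_one, pow_one] at h2
    exact hfix x h2
  refine ⟨fun n x => (z ^ n.val) x, h0, hadd, ?_, ?_⟩
  · intro m n x h
    change (z ^ m.val) x = (z ^ n.val) x at h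
    have h1 := hadd (m - n) n x
    rw [sub_add_cancel, h] at h1
    exact sub_eq_zero.mp (hfree _ _ h1.symm)
  · intro g hg n x
    have : ∀ k : ℕ, ∀ x, (z ^ k) (g x) = g ((z ^ k) x) := by
      intro k
      induction k with
      | zero => simp
      | succ k ih => intro x; rw [pow_succ, Equiv.Perm.mul_apply, hg, ih]; rfl
    exact this n.val x

/-- A transitive `p`-group on `p` points acts by translations. -/
lemma exists_equiv_zmod {G Y : Type*} [Group G] [MulAction G Y] (hY : Nat.card Y = p)
    (hG : IsPGroup p G) (htr : ∀ x y : Y, ∃ g : G, g • x = y) :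
    ∃ e : ZMod p ≃ Y, ∀ g : G, ∃ k, ∀ b, g • e b = e (b + k) := by
  have hp : p.Prime := Fact.out
  have : Finite Y := Nat.finite_of_card_ne_zero (hY ▸ hp.ne_zero)
  have : Nontrivial Y := Finite.one_lt_card_iff_nontrivial.mp (hY ▸ hp.one_lt)
  obtain ⟨z, hz, hzc, hfix⟩ := exists_central_perm hG htr
  obtain ⟨τ, h0, hadd, hinj, hτ⟩ := exists_free_action hz hfix
  obtain ⟨y₀⟩ : Nonempty Y := inferInstance
  have hbij : Function.Bijective fun n => τ n y₀ :=
    (Nat.bijective_iff_injective_and_card _).mpr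
      ⟨fun m n h => hinj m n y₀ h, by rw [hY, Nat.card_zmod]⟩
  refine ⟨Equiv.ofBijective _ hbij, fun g => ?_⟩
  obtain ⟨k, hk⟩ := hbij.surjective (g • y₀)
  refine ⟨k, fun b => ?_⟩
  change g • τ b y₀ = τ (b + k) y₀
  rw [hadd, ← hτ (fun y => g • y) (hzc g)]
  exact congrArg _ hk.symm

/-- A transitive `p`-group on `p ^ 2` points acts through a wreath product of cyclic groups. -/
theorem exists_equiv_zmod_prod {G X : Type*} [Group G] [MulAction G X]
    (hX : Nat.card X = p ^ 2) (hG : IsPGroup p G) (htr : ∀ x y : X, ∃ g : G, g • x = y) :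
    ∃ e : ZMod p × ZMod p ≃ X, ∀ g : G, ∃ (k : ZMod p) (f : ZMod p → ZMod p),
      ∀ b y, g • e (b, y) = e (b + k, y + f b) := by
  have hp : p.Prime := Fact.out
  have : Finite X := Nat.finite_of_card_ne_zero (hX ▸ pow_ne_zero _ hp.ne_zero)
  have : Nontrivial X := Finite.one_lt_card_iff_nontrivial.mp
    (hX ▸ Nat.one_lt_pow two_ne_zero hp.one_lt)
  obtain ⟨z, hz, hzc, hfix⟩ := exists_central_perm hG htr
  obtain ⟨τ, h0, hadd, hinj, hτ⟩ := exists_free_action hz hfix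
  have hτG : ∀ (g : G) n x, τ n (g • x) = g • τ n x := fun g => hτ (fun y => g • y) (hzc g)
  let S : Setoid X :=
    { r := fun x y => ∃ n, τ n x = y
      iseqv :=
        ⟨fun x => ⟨0, h0 x⟩, by
          rintro x y ⟨n, rfl⟩
          exact ⟨-n, by rw [← hadd, neg_add_cancel, h0]⟩, by
          rintro x y z ⟨n, rfl⟩ ⟨m, rfl⟩
          exact ⟨m + n, hadd m n x⟩⟩ }
  let Y := Quotient S
  let act : MulAction G Y :=
    { smul := fun g => Quotient.map (fun x => g • x) (by
        rintro x y ⟨n, rfl⟩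
        exact ⟨n, hτG g n x⟩)
      one_smul := by
        rintro ⟨x⟩
        exact congrArg (Quotient.mk S) (one_smul G x)
      mul_smul := by
        rintro g h ⟨x⟩
        exact congrArg (Quotient.mk S) (mul_smul g h x) }
  have hact : ∀ (g : G) (x : X), g • (Quotient.mk S x : Y) = Quotient.mk S (g • x) :=
    fun _ _ => rfl
  -- Coordinates: the `τ`-orbit, and the displacement from its chosen representative.
  have hsec : Function.Bijective fun u : Y × ZMod p => τ u.2 u.1.out := by
    constructor
    · rintro ⟨a, x⟩ ⟨b, y⟩ h
      simp only at h
      have hab : a = b := by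
        rw [← Quotient.out_eq a, ← Quotient.out_eq b]
        refine Quotient.sound ⟨-y + x, ?_⟩
        rw [hadd, h, ← hadd, neg_add_cancel, h0]
      subst hab
      rw [hinj _ _ _ h]
    · intro x
      obtain ⟨n, hn⟩ := Quotient.exact (Quotient.out_eq (Quotient.mk S x))
      exact ⟨(Quotient.mk S x, n), hn⟩
  have hY : Nat.card Y = p := by
    have h1 := Nat.card_congr (Equiv.ofBijective _ hsec)
    rw [Nat.card_prod, Nat.card_zmod, hX, sq] at h1
    exact Nat.eq_of_mul_eq_mul_right hp.pos h1
  obtain ⟨e, he⟩ := exists_equiv_zmod (G := G) hY hG (by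
    rintro ⟨x⟩ ⟨y⟩
    obtain ⟨g, hg⟩ := htr x y
    exact ⟨g, congrArg (Quotient.mk S) hg⟩)
  refine ⟨(e.prodCongr (Equiv.refl _)).trans (Equiv.ofBijective _ hsec), fun g => ?_⟩
  obtain ⟨k, hk⟩ := he g
  -- `g` sends the representative over `b` into the orbit over `b + k`; since `g` commutes with `τ`,
  -- one displacement serves the whole fibre.
  have hf : ∀ b, ∃ n, τ n (e (b + k)).out = g • (e b).out := by
    intro b
    have h1 : Quotient.mk S (e (b + k)).out = Quotient.mk S (g • (e b).out) := by
      rw [Quotient.out_eq, ← hk b, ← hact, Quotient.out_eq]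
    exact Quotient.exact h1
  choose f hf using hf
  refine ⟨k, f, fun b y => ?_⟩
  change g • τ y (e b).out = τ (y + f b) (e (b + k)).out
  rw [hadd, hf, hτG]

end PGroupAction

/-! ### Homomorphisms, and transitivity from indecomposability. -/

namespace CycleSet

lemma IsHom.comp {X Y Z : Type*} [CycleSet X] [CycleSet Y] [CycleSet Z] {f : X → Y} {g : Y → Z}
    (hg : IsHom g) (hf : IsHom f) : IsHom (g ∘ f) := fun x y => by
  simp only [Function.comp_apply]
  rw [hf, hg]

lemma IsHom.symm {X Y : Type*} [CycleSet X] [CycleSet Y] {e : X ≃ Y} (he : IsHom e) :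
    IsHom e.symm := fun x y => by
  rw [Equiv.symm_apply_eq, he, e.apply_symm_apply, e.apply_symm_apply]

/-- An orbit of the permutation group and its complement are both closed under the operation. -/
lemma IsIndecomposable.exists_smul_eq {X : Type*} [CycleSet X] [Finite X]
    (h : IsIndecomposable X) (x y : X) : ∃ g : permutationGroup X, g • x = y := by
  by_contra hxy
  have hmem : ∀ u : X, sigma u ∈ permutationGroup X := fun u =>
    Subgroup.subset_closure ⟨u, rfl⟩
  refine h (MulAction.orbit (permutationGroup X) x) (MulAction.orbit (permutationGroup X) x)ᶜ
    ⟨x, MulAction.mem_orbit_self x⟩ ⟨y, hxy⟩ disjoint_compl_right (Set.union_compl_self _) ?_ ?_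
  · intro u _ v hv
    exact (MulAction.mem_orbit_of_mem_orbit (⟨sigma u, hmem u⟩ : permutationGroup X) hv :)
  · intro u _ v hv huv
    apply hv
    have := MulAction.mem_orbit_of_mem_orbit (⟨sigma u, hmem u⟩ : permutationGroup X)⁻¹ huv
    convert this
    symm
    rw [inv_smul_eq_iff]
    rfl

end CycleSet

/-! ### Models, their injective homomorphisms, and the reduction of `X` to a model. -/

namespace EvenNonconst

open CycleSet

variable {p : ℕ}

lemma smul_toFun (α : (ZMod p)ˣ) (Φ : EvenNonconst p) (A : ZMod p) :
    (α • Φ).toFun A = ((α⁻¹ : (ZMod p)ˣ) : ZMod p) * Φ.toFun ((α : ZMod p) * A) := rfl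

/-- The element of the model with the given coordinates. -/
def Model.mk (Φ : EvenNonconst p) (a x : ZMod p) : Model Φ := ((a, x) : ZMod p × ZMod p)

lemma Model.op_mk (Φ : EvenNonconst p) (a x b y : ZMod p) :
    op (Model.mk Φ a x) (Model.mk Φ b y) = Model.mk Φ (b + x) (y + Φ.toFun (b - a)) := rfl

lemma Model.mk_inj {Φ : EvenNonconst p} {a x b y : ZMod p} :
    Model.mk Φ a x = Model.mk Φ b y ↔ a = b ∧ x = y := Prod.mk_inj

/-- Affine maps between models. -/
lemma isHom_of_apply_mk {Φ Ψ : EvenNonconst p} {e : Model Φ → Model Ψ} {α : (ZMod p)ˣ}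
    {β : ZMod p} (hΦ : Φ = α • Ψ)
    (he : ∀ a x, e (Model.mk Φ a x) = Model.mk Ψ (α * a + β) (α * x)) : IsHom e := by
  rintro ⟨a, x⟩ ⟨b, y⟩
  change e (op (Model.mk Φ a x) (Model.mk Φ b y)) = op (e (Model.mk Φ a x)) (e (Model.mk Φ b y))
  rw [Model.op_mk, he, he, he, Model.op_mk, Model.mk_inj]
  constructor
  · ring
  · rw [hΦ, smul_toFun, mul_add, Units.mul_inv_cancel_left]
    congr 2
    ring

/-- Injective homomorphisms between models are affine. -/
theorem exists_affine_of_isHom [Fact p.Prime] {Φ Ψ : EvenNonconst p} {e : Model Φ → Model Ψ}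
    (he : IsHom e) (hinj : Function.Injective e) :
    ∃ (α : (ZMod p)ˣ) (β : ZMod p), Φ = α • Ψ ∧
      ∀ a x, e (Model.mk Φ a x) = Model.mk Ψ (α * a + β) (α * x) := by
  obtain ⟨P, V, hPV⟩ : ∃ P V : ZMod p → ZMod p → ZMod p,
      ∀ a x, e (Model.mk Φ a x) = Model.mk Ψ (P a x) (V a x) :=
    ⟨fun a x => (e (Model.mk Φ a x)).1, fun a x => (e (Model.mk Φ a x)).2, fun _ _ => rfl⟩
  have hhom : ∀ a x b y, P (b + x) (y + Φ.toFun (b - a)) = P b y + V a x ∧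
      V (b + x) (y + Φ.toFun (b - a)) = V b y + Ψ.toFun (P b y - P a x) := by
    intro a x b y
    have h1 := he (Model.mk Φ a x) (Model.mk Φ b y)
    rwa [Model.op_mk, hPV, hPV, hPV, Model.op_mk, Model.mk_inj] at h1
  -- Two base points at which `Φ` takes different values show that shifting `y` by `Φ A - Φ B`, a
  -- generator of `ZMod p`, changes `P b y` by an amount independent of `y`.
  have haff : ∃ κ : ZMod p → ZMod p, ∀ b y, P b y = y * κ b + P b 0 := by
    obtain ⟨A, B, hAB⟩ := Φ.nonconst
    have hδ : Φ.toFun A - Φ.toFun B ≠ 0 := sub_ne_zero.mpr hAB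
    have hstep : ∀ b y, P b (y + (Φ.toFun A - Φ.toFun B)) =
        P b y + (V (b - A) 0 - V (b - B) 0) := by
      intro b y
      have h1 := (hhom (b - A) 0 b (y - Φ.toFun B)).1
      have h2 := (hhom (b - B) 0 b (y - Φ.toFun B)).1
      rw [sub_sub_cancel, add_zero] at h1 h2
      rw [sub_add_cancel] at h2
      rw [show y + (Φ.toFun A - Φ.toFun B) = y - Φ.toFun B + Φ.toFun A by ring, h1, h2]
      ring
    refine ⟨fun b => (V (b - A) 0 - V (b - B) 0) / (Φ.toFun A - Φ.toFun B), fun b y => ?_⟩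
    have hn : ∀ n : ℕ, P b (n * (Φ.toFun A - Φ.toFun B)) =
        n * (V (b - A) 0 - V (b - B) 0) + P b 0 := by
      intro n
      induction n with
      | zero => simp
      | succ n ih =>
        rw [Nat.cast_succ, add_mul, one_mul, hstep, ih]
        ring
    have h1 := hn (y / (Φ.toFun A - Φ.toFun B)).val
    rw [ZMod.natCast_zmod_val, div_mul_cancel₀ _ hδ] at h1
    rw [h1]
    ring
  obtain ⟨κ, hκ⟩ := haff
  have hκc : ∀ b, κ b = κ 0 := by
    intro b
    have h0 := (hhom 0 b 0 0).1
    have h1 := (hhom 0 b 0 1).1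
    rw [zero_add, hκ, hκ 0] at h0 h1
    linear_combination h1 - h0
  -- With `a = x = y = 0` the relation reads `Φ b * κ 0 = V 0 0` for all `b`; a nonzero slope would
  -- make `Φ` constant.
  have hκ0 : κ 0 = 0 := by
    by_contra hne
    obtain ⟨A, B, hAB⟩ := Φ.nonconst
    apply hAB
    have h1 := (hhom 0 0 A 0).1
    have h2 := (hhom 0 0 B 0).1
    rw [hκ, hκc, add_zero, sub_zero] at h1 h2
    refine mul_right_cancel₀ hne ?_
    linear_combination h1 - h2
  have hP : ∀ b y, P b y = P b 0 := by
    intro b y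
    rw [hκ, hκc, hκ0, mul_zero, zero_add]
  have hV : ∀ a x b, P (b + x) 0 = P b 0 + V a x := by
    intro a x b
    have := (hhom a x b 0).1
    rwa [hP, hP b] at this
  have hPlin : ∀ n : ℕ, P n 0 = n * V 0 1 + P 0 0 := by
    intro n
    induction n with
    | zero => simp
    | succ n ih =>
      rw [Nat.cast_succ, hV 0 1, ih]
      ring
  obtain ⟨γ, β, hPa, hVa⟩ : ∃ γ β, (∀ a x, P a x = γ * a + β) ∧ ∀ a x, V a x = γ * x := by
    have hPa : ∀ a x, P a x = V 0 1 * a + P 0 0 := by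
      intro a x
      have := hPlin a.val
      rw [ZMod.natCast_zmod_val] at this
      rw [hP, this, mul_comm]
    refine ⟨V 0 1, P 0 0, hPa, fun a x => ?_⟩
    have := hV a x 0
    rw [hPa, hPa 0] at this
    linear_combination -this
  have hγ : γ ≠ 0 := by
    intro h0
    have h1 : Model.mk Φ 0 0 = Model.mk Φ 0 1 := hinj (by
      rw [hPV, hPV, Model.mk_inj, hPa, hPa, hVa, hVa, h0]
      simp)
    exact zero_ne_one (Model.mk_inj.mp h1).2
  refine ⟨Units.mk0 γ hγ, β, ?_, fun a x => by rw [hPV, hPa, hVa, Units.val_mk0]⟩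
  apply EvenNonconst.ext
  funext A
  have h1 := (hhom 0 0 A 0).2
  rw [hVa, hVa, hPa, hPa, sub_zero] at h1
  rw [smul_toFun, Units.eq_inv_mul_iff_mul_eq, Units.val_mk0]
  rw [show γ * A + β - (γ * 0 + β) = γ * A by ring] at h1
  linear_combination h1

/-- The isomorphism between models of functions in the same orbit. -/
lemma exists_equiv_of_eq_smul {Φ Ψ : EvenNonconst p} {α : (ZMod p)ˣ} (h : Φ = α • Ψ) :
    ∃ e : Model Φ ≃ Model Ψ, IsHom e :=
  ⟨(α.mulLeft.prodCongr α.mulLeft : ZMod p × ZMod p ≃ ZMod p × ZMod p),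
    isHom_of_apply_mk (β := 0) h fun a x => by rw [add_zero]; rfl⟩

/-- Every indecomposable irretractable cycle set of size `p ^ 2` whose permutation group is a
`p`-group is isomorphic to a model. -/
theorem exists_equiv_model [Fact p.Prime] {X : Type*} [CycleSet X] (hcard : Nat.card X = p ^ 2)
    (hind : IsIndecomposable X) (hirr : IsIrretractable X) (hG : IsPGroup p (permutationGroup X)) :
    ∃ (Φ : EvenNonconst p) (e : X ≃ Model Φ), IsHom e := by
  have hp : p.Prime := Fact.out
  have : Finite X := Nat.finite_of_card_ne_zero (hcard ▸ pow_ne_zero _ hp.ne_zero)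
  obtain ⟨e, he⟩ := PGroupAction.exists_equiv_zmod_prod hcard hG hind.exists_smul_eq
  have hσ : ∀ u : ZMod p × ZMod p, ∃ (k : ZMod p) (f : ZMod p → ZMod p),
      ∀ b y, op (e u) (e (b, y)) = e (b + k, y + f b) := fun u =>
    he ⟨sigma (e u), Subgroup.subset_closure ⟨e u, rfl⟩⟩
  choose c' F' hcF using hσ
  obtain ⟨c, hc⟩ : ∃ c : ZMod p → ZMod p → ZMod p, ∀ a x, c' (a, x) = c x a :=
    ⟨fun x a => c' (a, x), fun _ _ => rfl⟩
  obtain ⟨F, hF⟩ : ∃ F : ZMod p → ZMod p → ZMod p → ZMod p, ∀ a x, F' (a, x) = F x a :=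
    ⟨fun x a => F' (a, x), fun _ _ => rfl⟩
  have hop : ∀ a x b y, op (e (a, x)) (e (b, y)) = e (b + c x a, y + F x a b) := by
    intro a x b y
    rw [hcF, hc, hF]
  have hdata : ∀ a x b y d, c x a + c (y + F x a b) (b + c x a) =
      c y b + c (x + F y b a) (a + c y b) ∧
      F x a d + F (y + F x a b) (b + c x a) (d + c x a) =
        F y b d + F (x + F y b a) (a + c y b) (d + c y b) := by
    intro a x b y d
    have h1 := op_op_op (e (a, x)) (e (b, y)) (e (d, 0))
    simp only [hop] at h1
    have h2 := Prod.mk_inj.mp (e.injective h1)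
    exact ⟨by linear_combination h2.1, by linear_combination h2.2⟩
  have h : WreathData.IsCycleData c F :=
    ⟨fun a x b y => (hdata a x b y 0).1, fun a x b y d => (hdata a x b y d).2⟩
  have hinj : Function.Injective fun u : ZMod p × ZMod p => (c u.2 u.1, F u.2 u.1) := by
    rintro ⟨a, x⟩ ⟨b, y⟩ hab
    obtain ⟨h1, h2⟩ := Prod.mk_inj.mp hab
    simp only at h1 h2
    refine e.injective (hirr ?_)
    simp only [inv_inj]
    ext v
    obtain ⟨⟨d, z⟩, rfl⟩ := e.surjective v
    change op (e (a, x)) (e (d, z)) = op (e (b, y)) (e (d, z))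
    rw [hop, hop, h1, h2]
  -- If `c` vanished, the whole group would preserve the first coordinate, against transitivity.
  have hne : ∃ x a, c x a ≠ 0 := by
    by_contra! h0
    have hfix : ∀ g ∈ permutationGroup X, ∀ v, (e.symm (g v)).1 = (e.symm v).1 := by
      intro g hg
      induction hg using Subgroup.closure_induction with
      | mem g hg =>
        obtain ⟨u, rfl⟩ := hg
        intro v
        obtain ⟨⟨a, x⟩, rfl⟩ := e.surjective u
        obtain ⟨⟨b, y⟩, rfl⟩ := e.surjective v
        change (e.symm (op (e (a, x)) (e (b, y)))).1 = _
        rw [hop, e.symm_apply_apply, e.symm_apply_apply, h0, add_zero]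
      | one => exact fun _ => rfl
      | mul g g' _ _ ih ih' =>
        intro v
        rw [Equiv.Perm.mul_apply, ih, ih']
      | inv g _ ih =>
        intro v
        rw [← ih (g⁻¹ v), ← Equiv.Perm.mul_apply, mul_inv_cancel, Equiv.Perm.one_apply]
    obtain ⟨⟨g, hg⟩, hgv⟩ := hind.exists_smul_eq (e (0, 0)) (e (1, 0))
    have h1 := hfix g hg (e (0, 0))
    rw [show g (e (0, 0)) = e (1, 0) from hgv, e.symm_apply_apply, e.symm_apply_apply] at h1
    exact one_ne_zero h1
  obtain ⟨Φ, hbij, hΦ⟩ := h.exists_even hinj hne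
  have hbij' : Function.Bijective fun u : ZMod p × ZMod p => Model.mk Φ u.1 (c u.2 u.1) := by
    constructor
    · rintro ⟨a, x⟩ ⟨b, y⟩ hab
      obtain ⟨h1, h2⟩ := Model.mk_inj.mp hab
      simp only at h1 h2
      subst h1
      rw [(hbij a).injective h2]
    · rintro ⟨a, z⟩
      obtain ⟨x, hx⟩ := (hbij a).surjective z
      exact ⟨(a, x), congrArg (Model.mk Φ a) hx⟩
  refine ⟨Φ, e.symm.trans (Equiv.ofBijective _ hbij'), fun u v => ?_⟩
  obtain ⟨⟨a, x⟩, rfl⟩ := e.surjective u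
  obtain ⟨⟨b, y⟩, rfl⟩ := e.surjective v
  simp only [hop, Equiv.trans_apply, Equiv.symm_apply_apply, Equiv.ofBijective_apply,
    Model.op_mk, hΦ]

end EvenNonconst

theorem mainTheorem4 (p : ℕ) [Fact p.Prime] (R : Set (EvenNonconst p))
    (hR : EvenNonconst.IsSystemOfRepresentatives R)
    {X : Type*} [CycleSet X] (hcard : Nat.card X = p ^ 2)
    (hind : CycleSet.IsIndecomposable X) (hirr : CycleSet.IsIrretractable X)
    (hG : IsPGroup p (CycleSet.permutationGroup X)) :
    (∃! Φ : EvenNonconst p, Φ ∈ R ∧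
      ∃ e : X ≃ EvenNonconst.Model Φ, CycleSet.IsHom e) ∧
    (∀ Φ ∈ R, ∀ e : X ≃ EvenNonconst.Model Φ, CycleSet.IsHom e →
      ∀ f : X ≃ X, CycleSet.IsHom f ↔
        ∃ (α : (ZMod p)ˣ) (β : ZMod p), α • Φ = Φ ∧
          ∀ a x : ZMod p, e (f (e.symm ((a, x) : ZMod p × ZMod p))) =
            (((α : ZMod p) * a + β, (α : ZMod p) * x) : ZMod p × ZMod p)) := by
  constructor
  · obtain ⟨Φ₀, e₀, he₀⟩ := EvenNonconst.exists_equiv_model hcard hind hirr hG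
    obtain ⟨Ψ, ⟨hΨR, α, hα⟩, -⟩ := hR Φ₀
    obtain ⟨e₁, he₁⟩ := EvenNonconst.exists_equiv_of_eq_smul (Φ := Φ₀) (Ψ := Ψ) (α := α⁻¹)
      (eq_inv_smul_iff.mpr hα)
    have he : CycleSet.IsHom (e₀.trans e₁) := he₁.comp he₀
    refine ⟨Ψ, ⟨hΨR, e₀.trans e₁, he⟩, ?_⟩
    rintro Φ ⟨hΦR, e', he'⟩
    obtain ⟨γ, β, hγ, -⟩ := EvenNonconst.exists_affine_of_isHom (he'.comp he.symm)
      (e'.injective.comp (e₀.trans e₁).symm.injective)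
    exact (hR Φ).unique ⟨hΦR, MulAction.mem_orbit_self Φ⟩ ⟨hΨR, γ, hγ.symm⟩
  · intro Φ _ e he f
    constructor
    · intro hf
      obtain ⟨α, β, hα, h⟩ := EvenNonconst.exists_affine_of_isHom (he.comp (hf.comp he.symm))
        (e.injective.comp (f.injective.comp e.symm.injective))
      exact ⟨α, β, hα.symm, h⟩
    · rintro ⟨α, β, hα, h⟩
      have h1 : CycleSet.IsHom (e ∘ f ∘ e.symm) :=
        EvenNonconst.isHom_of_apply_mk hα.symm h
      have h2 := he.symm.comp (h1.comp he)
      have h3 : (e.symm ∘ (e ∘ f ∘ e.symm) ∘ e : X → X) = f := by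
        funext x
        simp
      rwa [h3] at h2
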